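/- Let $H_1$ and $H_2$ be infinite-dimensional separable complex Hilbert spaces, and let $A_1\in\mathcal B(H_1)$ and $A_2\in\mathcal B(H_2)$ be positive bounded operators, i.e. $\langle A_jx,x\rangle\ge 0$ for all $x\in H_j$. Let $$T=A_1\oplus A_2=\begin{bmatrix}A_1&0\\0&A_2\end{bmatrix}$$ be the diagonal block operator $(x_1,x_2)\mapsto(A_1x_1,A_2x_2)$ on the Hilbert space direct sum $H_1\oplus H_2$. A bounded operator $S:H\to K$ between Hilbert spaces is called absolutely norm attaining, written $S\in\mathcal{AN}(H,K)$, or $S\in\mathcal{AN}(H)$ if $K=H$, if for every nonzero closed subspace $M\subseteq H$ there is a unit vector $x\in M$ with $\|Sx\|=\|S|_M\|$. The essential spectrum $\sigma_{ess}(S)$ of $S\in\mathcal B(H)$ is the set of all $\mu\in\mathbb C$ such that $S-\mu I$ is not Fredholm, where an operator $R\in\mathcal B(H)$ is Fredholm if its range is closed and the null spaces of $R$ and $R^*$ are finite-dimensional. Then $T\in\mathcal{AN}(H_1\oplus H_2)$ if and only if $A_1\in\mathcal{AN}(H_1)$, $A_2\in\mathcal{AN}(H_2)$ and $\sigma_{ess}(A_1)=\sigma_{ess}(A_2)$.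 -/

import Mathlib

noncomputable section

namespace BlockAN

variable {E F : Type*}
  [NormedAddCommGroup E] [InnerProductSpace ℂ E]
  [NormedAddCommGroup F] [InnerProductSpace ℂ F]

/-- `T` is norm attaining: there is a unit vector `x` with `‖T x‖ = ‖T‖`. -/
def NormAttaining (T : E →L[ℂ] F) : Prop :=
  ∃ x : E, ‖x‖ = 1 ∧ ‖T x‖ = ‖T‖

/-- `T` is absolutely norm attaining (an `AN`-operator): for every nonzero closed subspace `M`
of the domain, the restriction `T|_M : M → F` is norm attaining. -/
def AbsolutelyNormAttaining (T : E →L[ℂ] F) : Prop :=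
  ∀ M : Submodule ℂ E, IsClosed (M : Set E) → M ≠ ⊥ → NormAttaining (T ∘L M.subtypeL)

/-- The essential spectrum of `T`: the set of all `μ ∈ ℂ` for which `T - μ I` is not Fredholm. -/
def essentialSpectrum (T : E →L[ℂ] E) : Set ℂ :=
  {μ : ℂ | ¬ (T - μ • ContinuousLinearMap.id ℂ E).IsFredholm}

/-- The diagonal block operator `A ⊕ B`, sending `(x, y)` to `(A x, B y)`, on the Hilbert space
direct sum `E ⊕ F`, whose inner product is `⟪x, x'⟫ + ⟪y, y'⟫`. -/
def blockDiagonal (A : E →L[ℂ] E) (B : F →L[ℂ] F) :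
    WithLp 2 (E × F) →L[ℂ] WithLp 2 (E × F) :=
  (WithLp.prodContinuousLinearEquiv 2 ℂ E F).symm.toContinuousLinearMap ∘L
    (A.prodMap B) ∘L (WithLp.prodContinuousLinearEquiv 2 ℂ E F).toContinuousLinearMap

theorem blockDiagonal_apply (A : E →L[ℂ] E) (B : F →L[ℂ] F) (z : WithLp 2 (E × F)) :
    blockDiagonal A B z = WithLp.toLp 2 (A z.fst, B z.snd) := rfl

/-- Between Hilbert spaces, Mathlib's notion of a Fredholm operator says that the range of `T` is
closed and that the kernels of `T` and of its adjoint are finite dimensional. -/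
theorem isFredholm_iff [CompleteSpace E] [CompleteSpace F] (T : E →L[ℂ] F) :
    T.IsFredholm ↔ IsClosed (T.range : Set F) ∧ FiniteDimensional ℂ T.ker ∧
      FiniteDimensional ℂ (ContinuousLinearMap.adjoint T).ker := by
  have hperp : T.rangeᗮ = (ContinuousLinearMap.adjoint T).ker := T.orthogonal_range
  constructor
  · intro h
    refine ⟨h.isClosed_range, h.finite_ker, ?_⟩
    rw [← hperp]
    have : CompleteSpace T.range := h.isClosed_range.completeSpace_coe
    exact .of_fg (h.finite_coker.fg_of_isCompl T.range.isCompl_orthogonal)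
  · rintro ⟨hc, hk, ha⟩
    have : CompleteSpace T.range := hc.completeSpace_coe
    rw [← hperp] at ha
    have := hk
    refine ⟨?_, hc, hk, ?_, ?_⟩
    · have hs : Function.Surjective T.rangeRestrict := LinearMap.surjective_rangeRestrict _
      exact (T.rangeRestrict.isOpenMap hs).isQuotientMap T.rangeRestrict.continuous hs
    · exact Submodule.FG.cofg_of_isCompl T.range.isCompl_orthogonal.symm
        (Submodule.fg_iff_finiteDimensional _ |>.2 ha)
    · exact Submodule.ClosedComplemented.of_finiteDimensional T.ker

end BlockAN

end

namespace BlockAN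

open Filter Topology ContinuousLinearMap
open scoped InnerProductSpace ComplexOrder

/-! ### Norm attainment: a compactness criterion and an obstruction. -/

section Attainment

variable {E F E' F' : Type*}
  [NormedAddCommGroup E] [InnerProductSpace ℂ E]
  [NormedAddCommGroup F] [InnerProductSpace ℂ F]
  [NormedAddCommGroup E'] [InnerProductSpace ℂ E']
  [NormedAddCommGroup F'] [InnerProductSpace ℂ F']

/-! On an infinite-dimensional space, a positive operator `A` is absolutely norm attaining exactly
when, for some `α ≥ 0`, `A - α` is compact and `‖A x‖ ≥ α ‖x‖` on a subspace of finite codimension.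

For necessity (`exists_scalar_of_absolutelyNormAttaining`), norm attainment on invariant subspaces
supplies an eigenbasis. By `AbsolutelyNormAttaining.not_strictMono_norm`, the eigenvalues contain no
strictly increasing sequence and cannot accumulate at two points, so they cluster at a single `α`
with finitely many below it. Sufficiency is `absolutelyNormAttaining_of_isCompactOperator_sub`.

Such an `A` has essential spectrum `{α}`. If the two scalars agree, both properties pass to the
direct sum. Conversely, the summands inherit norm attainment, and compressing the compact operator
`T - α` to each summand forces both scalars to equal `α`. -/

theorem norm_adjoint_apply_sub_sq_le [CompleteSpace E] [CompleteSpace F] (S : E →L[ℂ] F)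
    {x : E} (hx : ‖x‖ = 1) :
    ‖adjoint S (S x) - ((‖S‖ ^ 2 : ℝ) : ℂ) • x‖ ^ 2 ≤ 2 * ‖S‖ ^ 2 * (‖S‖ ^ 2 - ‖S x‖ ^ 2) := by
  have h1 : ‖adjoint S (S x)‖ ≤ ‖S‖ ^ 2 := by
    calc ‖adjoint S (S x)‖ ≤ ‖adjoint S‖ * ‖S x‖ := le_opNorm _ _
      _ ≤ ‖S‖ * (‖S‖ * ‖x‖) := by
        rw [LinearIsometryEquiv.norm_map]; gcongr; exact le_opNorm _ _
      _ = ‖S‖ ^ 2 := by rw [hx]; ring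
  have h2 : RCLike.re ⟪adjoint S (S x), ((‖S‖ ^ 2 : ℝ) : ℂ) • x⟫_ℂ = ‖S‖ ^ 2 * ‖S x‖ ^ 2 := by
    rw [inner_smul_right, adjoint_inner_left, inner_self_eq_norm_sq_to_K]
    exact (congrArg Complex.re (by push_cast; rfl)).trans
      (Complex.ofReal_re (‖S‖ ^ 2 * ‖S x‖ ^ 2))
  have h3 : ‖((‖S‖ ^ 2 : ℝ) : ℂ) • x‖ = ‖S‖ ^ 2 := by
    rw [norm_smul, hx, Complex.norm_real, Real.norm_of_nonneg (by positivity), mul_one]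
  -- The square expands to `‖S*S x‖² - 2‖S‖²‖S x‖² + ‖S‖⁴`, whose first term is at most `‖S‖⁴`.
  rw [@norm_sub_sq ℂ, h2, h3]
  have : ‖adjoint S (S x)‖ ^ 2 ≤ (‖S‖ ^ 2) ^ 2 := by gcongr
  nlinarith

theorem adjoint_apply_apply_of_norm_eq [CompleteSpace E] [CompleteSpace F] (S : E →L[ℂ] F)
    {x : E} (hx : ‖x‖ = 1) (h : ‖S x‖ = ‖S‖) :
    adjoint S (S x) = ((‖S‖ ^ 2 : ℝ) : ℂ) • x := by
  have := norm_adjoint_apply_sub_sq_le S hx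
  rw [h, sub_self, mul_zero] at this
  have h0 : ‖adjoint S (S x) - ((‖S‖ ^ 2 : ℝ) : ℂ) • x‖ = 0 :=
    pow_eq_zero_iff two_ne_zero |>.1 (le_antisymm this (by positivity))
  exact sub_eq_zero.1 (norm_eq_zero.1 h0)

/-- A maximizing sequence of unit vectors `x n` satisfies `S*S x n - ‖S‖² x n → 0`, so `K x n` is
close to `(‖S‖² - c²) x n`. Compactness makes `K x n` converge along a subsequence, and since `‖S‖²
≠ c²`, so does `x n`; its limit is a maximizer. -/
theorem normAttaining_of_isCompactOperator [CompleteSpace E] [CompleteSpace F] (S : E →L[ℂ] F)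
    {c : ℝ} (hc : 0 ≤ c) (hcS : c < ‖S‖)
    (hK : IsCompactOperator (adjoint S ∘L S - ((c ^ 2 : ℝ) : ℂ) • ContinuousLinearMap.id ℂ E)) :
    NormAttaining S := by
  set K := adjoint S ∘L S - ((c ^ 2 : ℝ) : ℂ) • ContinuousLinearMap.id ℂ E with hKdef
  have hpos : 0 < ‖S‖ := hc.trans_lt hcS
  have hex : ∀ n : ℕ, ∃ x : E, ‖x‖ = 1 ∧ ‖S‖ - 1 / ((n : ℝ) + 1) < ‖S x‖ := by
    intro n
    have hlt : ‖S‖ - 1 / ((n : ℝ) + 1) < ‖S‖ := sub_lt_self _ Nat.one_div_pos_of_nat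
    -- The maximum with `0` guarantees `z ≠ 0`, so that `z` can be normalized.
    obtain ⟨z, hz, hz'⟩ := S.exists_lt_apply_of_lt_opNorm (max_lt hlt hpos)
    have hz0 : z ≠ 0 := by
      rintro rfl
      simp at hz'
    refine ⟨((‖z‖⁻¹ : ℝ) : ℂ) • z, ?_, ?_⟩
    · simpa using norm_smul_inv_norm (𝕜 := ℂ) hz0
    · refine ((le_max_left _ _).trans_lt hz').trans_le ?_
      rw [map_smul, norm_smul, Complex.norm_real, norm_inv, norm_norm]
      exact le_mul_of_one_le_left (norm_nonneg _) (one_le_inv₀ (norm_pos_iff.2 hz0) |>.2 hz.le)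
  choose x hx1 hx2 using hex
  have hSx : Tendsto (fun n => ‖S (x n)‖) atTop (𝓝 ‖S‖) := by
    refine tendsto_of_tendsto_of_tendsto_of_le_of_le (g := fun n : ℕ => ‖S‖ - 1 / ((n : ℝ) + 1))
      ?_ tendsto_const_nhds (fun n => (hx2 n).le) (fun n => ?_)
    · simpa using tendsto_const_nhds.sub (tendsto_one_div_add_atTop_nhds_zero_nat (𝕜 := ℝ))
    · simpa [hx1] using S.le_opNorm (x n)
  have hdefect : Tendsto (fun n => adjoint S (S (x n)) - ((‖S‖ ^ 2 : ℝ) : ℂ) • x n) atTop (𝓝 0) := by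
    rw [tendsto_zero_iff_norm_tendsto_zero]
    have hsq : Tendsto (fun n => ‖adjoint S (S (x n)) - ((‖S‖ ^ 2 : ℝ) : ℂ) • x n‖ ^ 2)
        atTop (𝓝 0) := by
      refine squeeze_zero (fun n => by positivity)
        (fun n => norm_adjoint_apply_sub_sq_le S (hx1 n)) ?_
      have := ((hSx.pow 2).const_sub (‖S‖ ^ 2)).const_mul (2 * ‖S‖ ^ 2)
      rwa [sub_self, mul_zero] at this
    simpa using hsq.sqrt
  have hKcpt : IsCompactOperator (K : E →ₗ[ℂ] E) := hK
  obtain ⟨y, -, φ, hφ, hy⟩ :=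
    (hKcpt.isCompact_closure_image_closedBall 1).tendsto_subseq (x := fun n => K (x n))
    (fun n => subset_closure ⟨x n, by simp [hx1], rfl⟩)
  have hd : (((‖S‖ ^ 2 - c ^ 2 : ℝ)) : ℂ) ≠ 0 := by
    have : 0 < ‖S‖ ^ 2 - c ^ 2 := by nlinarith
    exact_mod_cast this.ne'
  have hlim : Tendsto (fun n => x (φ n)) atTop (𝓝 ((((‖S‖ ^ 2 - c ^ 2 : ℝ)) : ℂ)⁻¹ • y)) := by
    have h1 := (hy.sub (hdefect.comp hφ.tendsto_atTop)).const_smul (((‖S‖ ^ 2 - c ^ 2 : ℝ)) : ℂ)⁻¹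
    rw [sub_zero] at h1
    refine h1.congr fun n => ?_
    have : K (x (φ n)) - (adjoint S (S (x (φ n))) - ((‖S‖ ^ 2 : ℝ) : ℂ) • x (φ n))
        = (((‖S‖ ^ 2 - c ^ 2 : ℝ)) : ℂ) • x (φ n) := by
      simp only [hKdef, sub_apply, comp_apply, smul_apply, id_apply]
      push_cast
      module
    simp only [Function.comp_apply, this]
    rw [inv_smul_smul₀ hd]
  refine ⟨_, ?_, tendsto_nhds_unique ((S.continuous.tendsto _).comp hlim).norm
    (hSx.comp hφ.tendsto_atTop)⟩
  refine tendsto_nhds_unique hlim.norm ?_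
  simp [hx1]

/-- A self-adjoint compact perturbation of a nonnegative scalar which is bounded below by that
scalar on a subspace of finite codimension is absolutely norm attaining. -/
theorem absolutelyNormAttaining_of_isCompactOperator_sub [CompleteSpace E] {A : E →L[ℂ] E}
    (hA : IsSelfAdjoint A) {α : ℝ} (hα : 0 ≤ α)
    (hK : IsCompactOperator (A - (α : ℂ) • ContinuousLinearMap.id ℂ E))
    (W : Submodule ℂ E) [FiniteDimensional ℂ W] (hW : ∀ x ∈ Wᗮ, α * ‖x‖ ≤ ‖A x‖) :
    AbsolutelyNormAttaining A := by
  intro M hM hM0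
  have : CompleteSpace M := hM.completeSpace_coe
  set S := A ∘L M.subtypeL with hS
  obtain ⟨m, hm, hm0⟩ := M.exists_mem_ne_zero_of_ne_bot hM0
  -- If `M` misses `Wᗮ`, it embeds in `W` and is finite-dimensional. Otherwise a unit vector of `M ⊓
  -- Wᗮ` shows `‖S‖ ≥ α`: on equality that vector is a maximizer, and on strict inequality the
  -- compactness criterion applies with `c = α`.
  by_cases hMW : M ⊓ Wᗮ = ⊥
  · have hfin : FiniteDimensional ℂ M := by
      refine FiniteDimensional.of_injective (W.orthogonalProjectionOnto.toLinearMap ∘ₗ M.subtype) ?_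
      rw [← LinearMap.ker_eq_bot, LinearMap.ker_eq_bot']
      intro x hx
      have : (x : E) ∈ M ⊓ Wᗮ := ⟨x.2, by
        simpa using hx⟩
      rw [hMW, Submodule.mem_bot] at this
      exact_mod_cast this
    rcases (norm_nonneg S).eq_or_lt with h0 | h0
    · refine ⟨((‖m‖⁻¹ : ℝ) : ℂ) • ⟨m, hm⟩, ?_, ?_⟩
      · have : (⟨m, hm⟩ : M) ≠ 0 := by simpa using hm0
        simpa using norm_smul_inv_norm (𝕜 := ℂ) this
      · refine le_antisymm ?_ (h0 ▸ norm_nonneg _)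
        have := S.le_opNorm (((‖m‖⁻¹ : ℝ) : ℂ) • ⟨m, hm⟩)
        simpa [← h0] using this
    · exact normAttaining_of_isCompactOperator S le_rfl h0
        (isCompactOperator_of_locallyCompactSpace_dom _)
  · obtain ⟨z, ⟨hzM, hzW⟩, hz0⟩ := (M ⊓ Wᗮ).exists_mem_ne_zero_of_ne_bot hMW
    let x : M := ((‖z‖⁻¹ : ℝ) : ℂ) • ⟨z, hzM⟩
    have hx1 : ‖x‖ = 1 := by
      have : (⟨z, hzM⟩ : M) ≠ 0 := by simpa using hz0
      simpa [x] using norm_smul_inv_norm (𝕜 := ℂ) this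
    have hxα : α ≤ ‖S x‖ := by
      have := hW x (Submodule.smul_mem _ _ hzW)
      have hx1' : ‖(x : E)‖ = 1 := hx1
      rwa [hx1', mul_one] at this
    have hSx : ‖S x‖ ≤ ‖S‖ := by simpa [hx1] using S.le_opNorm x
    rcases (hxα.trans hSx).eq_or_lt with h | h
    · exact ⟨x, hx1, hSx.antisymm (h ▸ hxα)⟩
    · refine normAttaining_of_isCompactOperator S hα h ?_
      -- This is `A² - α² = (A - α)(A + α)` compressed to `M`.
      have key : adjoint S ∘L S - ((α ^ 2 : ℝ) : ℂ) • ContinuousLinearMap.id ℂ M =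
          adjoint M.subtypeL ∘L ((A - (α : ℂ) • ContinuousLinearMap.id ℂ E) ∘L
            ((A + (α : ℂ) • ContinuousLinearMap.id ℂ E) ∘L M.subtypeL)) := by
        have hid : adjoint M.subtypeL ∘L M.subtypeL = ContinuousLinearMap.id ℂ M := by
          ext1 y
          refine ext_inner_right ℂ fun w => ?_
          simp [adjoint_inner_left]
        rw [← hid, hS, adjoint_comp, hA.adjoint_eq]
        ext1 y
        simp only [sub_apply, add_apply, comp_apply, smul_apply, id_apply, map_add, map_sub,
          map_smul]
        push_cast
        module
      rw [key]
      exact (hK.comp_clm ((A + (α : ℂ) • ContinuousLinearMap.id ℂ E) ∘L M.subtypeL)).clm_comp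
        (adjoint M.subtypeL)

theorem AbsolutelyNormAttaining.of_linearIsometry [CompleteSpace E] {T : E' →L[ℂ] F'}
    (hT : AbsolutelyNormAttaining T) {S : E →L[ℂ] F} (U : E →ₗᵢ[ℂ] E') (V : F →ₗᵢ[ℂ] F')
    (h : ∀ x, T (U x) = V (S x)) : AbsolutelyNormAttaining S := by
  intro M hM hM0
  have hcl : IsClosed ((M.map U.toLinearMap : Submodule ℂ E') : Set E') := by
    rw [Submodule.map_coe]
    exact U.isometry.isClosedEmbedding.isClosedMap _ hM
  have hne : M.map U.toLinearMap ≠ ⊥ := by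
    obtain ⟨m, hm, hm0⟩ := M.exists_mem_ne_zero_of_ne_bot hM0
    refine Submodule.ne_bot_iff _ |>.2 ⟨U m, ⟨m, hm, rfl⟩, ?_⟩
    rwa [Ne, map_eq_zero_iff U U.injective]
  obtain ⟨⟨_, x, hx, rfl⟩, hx1, hx2⟩ := hT _ hcl hne
  refine ⟨⟨x, hx⟩, ?_, ?_⟩
  · rw [← hx1]; exact (U.norm_map x).symm
  · have e : ∀ y, ‖T (U y)‖ = ‖S y‖ := fun y => by rw [h, V.norm_map]
    refine le_antisymm ?_ ?_
    · simpa using (S ∘L M.subtypeL).le_of_opNorm_le_of_le le_rfl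
        (show ‖(⟨x, hx⟩ : M)‖ ≤ 1 by rw [← hx1]; exact (U.norm_map x).ge)
    · refine opNorm_le_bound _ (norm_nonneg _) fun y => ?_
      have := (T ∘L (M.map U.toLinearMap).subtypeL).le_opNorm ⟨U y, y, y.2, rfl⟩
      rw [← hx2] at this
      simp only [comp_apply, Submodule.subtypeL_apply, Submodule.coe_norm] at this ⊢
      have h1 : ‖T (U.toLinearMap x)‖ = ‖S x‖ := e x
      rwa [e, h1, U.norm_map] at this

/-- A maximizer on `M` is an eigenvector of the compression of `S*S` to `M`; here that equation is
tested against vectors of `M`. -/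
theorem exists_inner_eq_of_absolutelyNormAttaining [CompleteSpace E] [CompleteSpace F]
    {S : E →L[ℂ] F} (hS : AbsolutelyNormAttaining S) (M : Submodule ℂ E)
    (hM : IsClosed (M : Set E)) (hM0 : M ≠ ⊥) :
    ∃ x ∈ M, ∃ γ : ℝ, 0 ≤ γ ∧ ‖x‖ = 1 ∧ (∀ y ∈ M, ‖S y‖ ≤ γ * ‖y‖) ∧
      ∀ y ∈ M, ⟪S y, S x⟫_ℂ = ((γ ^ 2 : ℝ) : ℂ) * ⟪y, x⟫_ℂ := by
  have : CompleteSpace M := hM.completeSpace_coe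
  obtain ⟨x, hx1, hx2⟩ := hS M hM hM0
  have h := adjoint_apply_apply_of_norm_eq _ hx1 hx2
  refine ⟨x, x.2, ‖S ∘L M.subtypeL‖, opNorm_nonneg _, hx1, fun y hy => ?_, fun y hy => ?_⟩
  · exact (S ∘L M.subtypeL).le_opNorm ⟨y, hy⟩
  · have h' := congrArg (fun z => ⟪(⟨y, hy⟩ : M), z⟫_ℂ) h
    simp only [adjoint_inner_right, inner_smul_right] at h'
    exact h'

/-- An absolutely norm attaining operator cannot map an orthonormal sequence to an orthogonal
sequence with strictly increasing norms. -/
theorem AbsolutelyNormAttaining.not_strictMono_norm [CompleteSpace E] [CompleteSpace F]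
    {S : E →L[ℂ] F} (hS : AbsolutelyNormAttaining S) {v : ℕ → E} (hv : Orthonormal ℂ v)
    (hSv : Pairwise fun m n => ⟪S (v m), S (v n)⟫_ℂ = 0) : ¬ StrictMono fun n => ‖S (v n)‖ := by
  intro hmono
  set M := (Submodule.span ℂ (Set.range v)).topologicalClosure with hMdef
  have hvM : ∀ n, v n ∈ M := fun n =>
    Submodule.le_topologicalClosure _ (Submodule.subset_span ⟨n, rfl⟩)
  have hM0 : M ≠ ⊥ := fun h => hv.ne_zero 0 ((Submodule.mem_bot ℂ).1 (h ▸ hvM 0))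
  obtain ⟨x, hxM, γ, hγ, hx1, hle, hin⟩ := exists_inner_eq_of_absolutelyNormAttaining hS M
    (Submodule.isClosed_topologicalClosure _) hM0
  have hlt : ∀ n, ‖S (v n)‖ < γ := fun n =>
    (hmono n.lt_succ_self).trans_le (by simpa [hv.1] using hle _ (hvM (n + 1)))
  -- On `M`, the functional `⟪S (v n), S ·⟫` is a multiple of `⟪v n, ·⟫`.
  have hdiag : ∀ n, ∀ y ∈ M, ⟪S (v n), S y⟫_ℂ = ((‖S (v n)‖ ^ 2 : ℝ) : ℂ) * ⟪v n, y⟫_ℂ := by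
    intro n
    let f : E →L[ℂ] ℂ := innerSL ℂ (S (v n)) ∘L S - ((‖S (v n)‖ ^ 2 : ℝ) : ℂ) • innerSL ℂ (v n)
    have hf : M ≤ f.ker := by
      refine Submodule.topologicalClosure_minimal _ ?_ f.isClosed_ker
      rw [Submodule.span_le]
      rintro _ ⟨m, rfl⟩
      rcases eq_or_ne n m with rfl | hnm
      · simp [f, inner_self_eq_norm_sq_to_K, hv.1]
      · simp [f, hSv hnm, hv.2 hnm]
    intro y hy
    have := hf hy
    simpa [f, sub_eq_zero] using this
  -- The maximizer `x` belongs to `γ²`, which exceeds every diagonal entry `‖S (v n)‖²`, so all its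
  -- coefficients vanish.
  have hperp : ∀ n, ⟪v n, x⟫_ℂ = 0 := by
    intro n
    have h1 := (hdiag n x hxM).symm.trans (hin _ (hvM n))
    rw [← sub_eq_zero, ← sub_mul, mul_eq_zero] at h1
    refine h1.resolve_left ?_
    have : ‖S (v n)‖ ^ 2 < γ ^ 2 := by
      have := hlt n
      gcongr
    rw [← Complex.ofReal_sub]
    exact_mod_cast (sub_neg.2 this).ne
  have hx : M ≤ (innerSL ℂ x).ker := by
    refine Submodule.topologicalClosure_minimal _ ?_ (innerSL ℂ x).isClosed_ker
    rw [Submodule.span_le]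
    rintro _ ⟨m, rfl⟩
    simp [inner_eq_zero_symm.1 (hperp m)]
  have := hx hxM
  simp only [LinearMap.mem_ker, ContinuousLinearMap.coe_coe, innerSL_apply_apply,
    inner_self_eq_zero] at this
  simp [this] at hx1

theorem norm_le_norm_of_hilbertBasis {ι : Type*} (b : HilbertBasis ι ℂ E) {x y : E}
    (h : ∀ i, ‖⟪b i, x⟫_ℂ‖ ≤ ‖⟪b i, y⟫_ℂ‖) : ‖x‖ ≤ ‖y‖ := by
  have hsum : ∀ z : E, HasSum (fun i => ‖⟪b i, z⟫_ℂ‖ ^ 2) (‖z‖ ^ 2) := by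
    intro z
    have := (b.hasSum_inner_mul_inner z z).mapL Complex.reCLM
    convert! this using 1
    · ext i
      rw [← inner_conj_symm z (b i), Complex.conj_mul']
      exact (Complex.ofReal_re (‖⟪b i, z⟫_ℂ‖ ^ 2)).symm.trans (congrArg Complex.re (by push_cast; rfl))
    · rw [inner_self_eq_norm_sq_to_K]
      exact (Complex.ofReal_re (‖z‖ ^ 2)).symm.trans (congrArg Complex.re (by push_cast; rfl))
  refine pow_le_pow_iff_left₀ (norm_nonneg _) (norm_nonneg _) two_ne_zero |>.1 ?_
  exact hasSum_le (fun i => by gcongr; exact h i) (hsum x) (hsum y)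

end Attainment

/-! ### Eigenvalues of positive absolutely norm attaining operators. -/

section Diagonalization

universe u

variable {E : Type u} [NormedAddCommGroup E] [InnerProductSpace ℂ E] [CompleteSpace E]

/-- An invariant closed subspace of a positive absolutely norm attaining operator contains a unit
eigenvector. -/
theorem exists_eigenvector_of_absolutelyNormAttaining {A : E →L[ℂ] E} (hA : A.IsPositive)
    (hAN : AbsolutelyNormAttaining A) (N : Submodule ℂ E) (hN : IsClosed (N : Set E))
    (hN0 : N ≠ ⊥) (hinv : ∀ x ∈ N, A x ∈ N) :
    ∃ x ∈ N, ‖x‖ = 1 ∧ ∃ γ : ℝ, 0 ≤ γ ∧ A x = (γ : ℂ) • x := by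
  obtain ⟨x, hx, γ, hγ, hx1, hle, hin⟩ := exists_inner_eq_of_absolutelyNormAttaining hAN N hN hN0
  refine ⟨x, hx, hx1, γ, hγ, ?_⟩
  rcases hγ.eq_or_lt with rfl | hγ
  · have := hle x hx
    rw [zero_mul, norm_le_zero_iff] at this
    simp [this]
  have hsq : A (A x) = ((γ ^ 2 : ℝ) : ℂ) • x := by
    have hmem : A (A x) - ((γ ^ 2 : ℝ) : ℂ) • x ∈ N :=
      N.sub_mem (hinv _ (hinv _ hx)) (N.smul_mem _ hx)
    rw [← sub_eq_zero, ← inner_self_eq_zero (𝕜 := ℂ), inner_sub_right, inner_smul_right,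
      ← hA.inner_left_eq_inner_right, hin _ hmem, sub_self]
  -- Since `(A + γ)(A - γ) x = 0`, `z` satisfies `A z = -γ z`, which positivity and `γ > 0` permit
  -- only for `z = 0`.
  set z := A x - (γ : ℂ) • x with hz
  have hAz : A z = -((γ : ℂ) • z) := by
    rw [hz, map_sub, map_smul, hsq]
    push_cast
    module
  have h1 := hA.re_inner_nonneg_left z
  rw [hAz, inner_neg_left, inner_smul_left, inner_self_eq_norm_sq_to_K] at h1
  have h2 : RCLike.re (-((starRingEnd ℂ) (γ : ℂ) * ((‖z‖ : ℂ)) ^ 2)) = -(γ * ‖z‖ ^ 2) := by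
    rw [Complex.conj_ofReal]
    exact (congrArg Complex.re (by push_cast; rfl)).trans (Complex.ofReal_re (-(γ * ‖z‖ ^ 2)))
  have h3 : 0 ≤ -(γ * ‖z‖ ^ 2) := h2 ▸ h1
  have h4 : ‖z‖ ^ 2 = 0 := by
    have := sq_nonneg ‖z‖
    nlinarith
  exact sub_eq_zero.1 (norm_eq_zero.1 (pow_eq_zero_iff two_ne_zero |>.1 h4))

/-- A positive absolutely norm attaining operator is diagonalizable. -/
theorem exists_hilbertBasis_of_absolutelyNormAttaining {A : E →L[ℂ] E} (hA : A.IsPositive)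
    (hAN : AbsolutelyNormAttaining A) :
    ∃ (ι : Type u) (b : HilbertBasis ι ℂ E) (l : ι → ℝ),
      (∀ i, 0 ≤ l i) ∧ ∀ i, A (b i) = (l i : ℂ) • b i := by
  obtain ⟨s, hs⟩ := zorn_subset
    {s : Set E | Orthonormal ℂ ((↑) : s → E) ∧ ∀ x ∈ s, ∃ γ : ℝ, 0 ≤ γ ∧ A x = (γ : ℂ) • x} (by
    intro c hc hchain
    refine ⟨⋃₀ c, ⟨orthonormal_sUnion_of_directed hchain.directedOn fun x hx => (hc hx).1, ?_⟩,
      fun _ => Set.subset_sUnion_of_mem⟩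
    rintro x ⟨t, ht, hxt⟩
    exact (hc ht).2 x hxt)
  -- The complement of a span of eigenvectors is invariant by symmetry, so if nonzero it would
  -- contain an eigenvector enlarging the maximal set.
  have hbot : (Submodule.span ℂ s)ᗮ = ⊥ := by
    by_contra hne
    obtain ⟨x, hx, hx1, hγ⟩ := exists_eigenvector_of_absolutelyNormAttaining hA hAN _
      (Submodule.isClosed_orthogonal _) hne (by
        intro x hx
        rw [Submodule.mem_orthogonal] at hx ⊢
        have hinv : ∀ w ∈ Submodule.span ℂ s, A w ∈ Submodule.span ℂ s := by
          intro w hw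
          refine Submodule.span_le (p := (Submodule.span ℂ s).comap A.toLinearMap) |>.2 ?_ hw
          intro w hw
          obtain ⟨γ, -, hγ⟩ := hs.1.2 w hw
          simp only [Submodule.comap_coe, Set.mem_preimage, ContinuousLinearMap.coe_coe, hγ]
          exact Submodule.smul_mem _ _ (Submodule.subset_span hw)
        intro w hw
        rw [← hA.inner_left_eq_inner_right]
        exact hx _ (hinv w hw))
    have hperp : ∀ y ∈ s, ⟪y, x⟫_ℂ = 0 := fun y hy =>
      (Submodule.mem_orthogonal _ _).1 hx y (Submodule.subset_span hy)
    have hins : Orthonormal ℂ ((↑) : ↥(insert x s) → E) := by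
      refine ⟨?_, ?_⟩
      · rintro ⟨y, rfl | hy⟩
        · exact hx1
        · exact hs.1.1.1 ⟨y, hy⟩
      · rintro ⟨y, hy⟩ ⟨z, hz⟩ hyz
        have hyz' : y ≠ z := fun h => hyz (Subtype.ext h)
        rcases hy with rfl | hy <;> rcases hz with rfl | hz
        · exact absurd rfl hyz'
        · exact inner_eq_zero_symm.1 (hperp z hz)
        · exact hperp y hy
        · exact hs.1.1.2 (i := ⟨y, hy⟩) (j := ⟨z, hz⟩) (fun h => hyz' (congrArg Subtype.val h))
    have hxs : x ∈ s := by
      refine hs.2 (y := insert x s) ⟨hins, ?_⟩ (Set.subset_insert _ _) (Set.mem_insert _ _)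
      rintro y (rfl | hy)
      · exact hγ
      · exact hs.1.2 y hy
    have := hperp x hxs
    rw [inner_self_eq_zero] at this
    simp [this] at hx1
  have hex : ∀ i : s, ∃ γ : ℝ, 0 ≤ γ ∧ A i = (γ : ℂ) • (i : E) := fun i => hs.1.2 i i.2
  choose l hl0 hl using hex
  refine ⟨s, HilbertBasis.mkOfOrthogonalEqBot hs.1.1 (by rwa [Subtype.range_coe]), l, hl0, ?_⟩
  intro i
  simpa using hl i

theorem inner_apply_eq_of_apply_eq_smul {A : E →L[ℂ] E} (hA : IsSelfAdjoint A) {e : E} {l : ℝ}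
    (h : A e = (l : ℂ) • e) (x : E) : ⟪e, A x⟫_ℂ = (l : ℂ) * ⟪e, x⟫_ℂ := by
  rw [← adjoint_inner_left, hA.adjoint_eq, h, inner_smul_left, Complex.conj_ofReal]

/-- The eigenvalues of a positive absolutely norm attaining operator cannot have infinitely many
terms on each side of a gap. -/
theorem finite_or_finite_of_absolutelyNormAttaining {ι : Type*} {A : E →L[ℂ] E}
    (hAN : AbsolutelyNormAttaining A) {b : ι → E} (hb : Orthonormal ℂ b) {l : ι → ℝ}
    (hl0 : ∀ i, 0 ≤ l i) (hl : ∀ i, A (b i) = (l i : ℂ) • b i) {r s : ℝ} (hrs : r < s) :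
    {i | l i ≤ r}.Finite ∨ {i | s ≤ l i}.Finite := by
  by_contra! hcon
  obtain ⟨hr, hs⟩ := hcon
  let g := hr.natEmbedding
  let f := hs.natEmbedding
  have hg : ∀ n, l (g n) ≤ r := fun n => (g n).2
  have hf : ∀ n, s ≤ l (f n) := fun n => (f n).2
  have hr0 : 0 ≤ r := (hl0 _).trans (hg 0)
  have hne : ∀ m n, (g m : ι) ≠ f n := fun m n h => by
    have h1 := hg m
    rw [h] at h1
    linarith [hf n]
  have hgg : ∀ m n, m ≠ n → (g m : ι) ≠ g n := fun m n h h' => h (g.injective (Subtype.ext h'))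
  have hff : ∀ m n, m ≠ n → (f m : ι) ≠ f n := fun m n h h' => h (f.injective (Subtype.ext h'))
  -- target values strictly increasing between `r ^ 2` and `s ^ 2`
  let t : ℕ → ℝ := fun n => s ^ 2 - (s ^ 2 - r ^ 2) * (1 / ((n : ℝ) + 1))
  have hrs2 : r ^ 2 < s ^ 2 := by gcongr
  have htr : ∀ n, r ^ 2 ≤ t n := by
    intro n
    have : 1 / ((n : ℝ) + 1) ≤ 1 := by
      rw [div_le_one (by positivity)]
      linarith [(Nat.cast_nonneg n : (0 : ℝ) ≤ n)]
    simp only [t]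
    nlinarith
  have hts : ∀ n, t n ≤ s ^ 2 := by
    intro n
    have : 0 < 1 / ((n : ℝ) + 1) := Nat.one_div_pos_of_nat
    simp only [t]
    nlinarith
  have htmono : StrictMono t := by
    refine strictMono_nat_of_lt_succ fun n => ?_
    have : 1 / (((n + 1 : ℕ) : ℝ) + 1) < 1 / ((n : ℝ) + 1) := Nat.one_div_lt_one_div n.lt_succ_self
    simp only [t]
    nlinarith
  have hlg : ∀ n, l (g n) ^ 2 ≤ r ^ 2 := fun n => by
    have := hl0 (g n); have := hg n; gcongr
  have hlf : ∀ n, s ^ 2 ≤ l (f n) ^ 2 := fun n => by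
    have := hf n; have : 0 ≤ s := hr0.trans hrs.le; gcongr
  -- The weight solves `p l(f n)² + (1 - p) l(g n)² = t n`. Mixing disjoint pairs of eigenvectors
  -- with it keeps the images orthogonal and gives `‖A (v n)‖² = t n`.
  let p : ℕ → ℝ := fun n => (t n - l (g n) ^ 2) / (l (f n) ^ 2 - l (g n) ^ 2)
  have hden : ∀ n, 0 < l (f n) ^ 2 - l (g n) ^ 2 := fun n => by linarith [hlg n, hlf n]
  have hp0 : ∀ n, 0 ≤ p n := fun n => div_nonneg (by linarith [hlg n, htr n]) (hden n).le
  have hp1 : ∀ n, 0 ≤ 1 - p n := fun n => by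
    rw [sub_nonneg, div_le_one (hden n)]
    linarith [hlf n, hts n]
  have hpt : ∀ n, p n * l (f n) ^ 2 + (1 - p n) * l (g n) ^ 2 = t n := fun n => by
    have : p n * (l (f n) ^ 2 - l (g n) ^ 2) = t n - l (g n) ^ 2 := div_mul_cancel₀ _ (hden n).ne'
    linarith
  let v : ℕ → E := fun n => ((√(p n) : ℝ) : ℂ) • b (f n) + ((√(1 - p n) : ℝ) : ℂ) • b (g n)
  have hcomb : ∀ (m n : ℕ) (a c a' c' : ℝ),
      ⟪(a : ℂ) • b (f m) + (c : ℂ) • b (g m), (a' : ℂ) • b (f n) + (c' : ℂ) • b (g n)⟫_ℂ =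
        if m = n then ((a * a' + c * c' : ℝ) : ℂ) else 0 := by
    intro m n a c a' c'
    simp only [inner_add_left, inner_add_right, inner_smul_left, inner_smul_right,
      Complex.conj_ofReal, hb.2 (hne m n), hb.2 (hne n m).symm]
    split_ifs with h
    · subst h
      simp only [inner_self_eq_norm_sq_to_K, hb.1]
      simp [mul_comm]
    · simp [hb.2 (hgg m n h), hb.2 (hff m n h)]
  have hAv : ∀ n, A (v n) = ((√(p n) * l (f n) : ℝ) : ℂ) • b (f n) +
      ((√(1 - p n) * l (g n) : ℝ) : ℂ) • b (g n) := by
    intro n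
    simp only [v, map_add, map_smul, hl, smul_smul]
    push_cast
    rfl
  have hv : Orthonormal ℂ v := by
    rw [orthonormal_iff_ite]
    intro m n
    simp only [v, hcomb]
    split_ifs with h
    · subst h
      rw [Real.mul_self_sqrt (hp0 m), Real.mul_self_sqrt (hp1 m)]
      simp
    · rfl
  refine hAN.not_strictMono_norm hv (fun m n h => ?_) ?_
  · simp only [hAv, hcomb, if_neg h]
  · have hnorm : ∀ n, ‖A (v n)‖ ^ 2 = t n := by
      intro n
      have h1 : ((‖A (v n)‖ ^ 2 : ℝ) : ℂ) = ((t n : ℝ) : ℂ) := by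
        have h2 := inner_self_eq_norm_sq_to_K (𝕜 := ℂ) (A (v n))
        have h3 : (√(p n) * l (f n)) * (√(p n) * l (f n)) +
            (√(1 - p n) * l (g n)) * (√(1 - p n) * l (g n)) = t n := by
          rw [← hpt n]
          linear_combination l (f n) ^ 2 * Real.mul_self_sqrt (hp0 n) +
            l (g n) ^ 2 * Real.mul_self_sqrt (hp1 n)
        rw [hAv, hcomb, if_pos rfl, h3, ← hAv] at h2
        rw [h2]
        push_cast
        rfl
      exact_mod_cast h1
    intro m n hmn
    refine lt_of_pow_lt_pow_left₀ 2 (norm_nonneg _) ?_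
    rw [hnorm, hnorm]
    exact htmono hmn

/-- If an infinite family of numbers in `[0, C]` has no gap with infinitely many terms on both sides
and no strictly increasing sequence, then it converges to some `α`, with only finitely many terms
below `α`. -/
theorem exists_limit_of_finite_or_finite {ι : Type*} [Infinite ι] {l : ι → ℝ} {C : ℝ}
    (hl0 : ∀ i, 0 ≤ l i) (hlC : ∀ i, l i ≤ C)
    (hgap : ∀ r s : ℝ, r < s → {i | l i ≤ r}.Finite ∨ {i | s ≤ l i}.Finite)
    (hinc : ∀ f : ℕ → ι, ¬ StrictMono (l ∘ f)) :
    ∃ α : ℝ, 0 ≤ α ∧ {i | l i < α}.Finite ∧ ∀ ε > 0, {i | ε < |l i - α|}.Finite := by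
  -- Its supremum, the upper limit of the family, will be `α`.
  let X : Set ℝ := {t | {i | t ≤ l i}.Infinite}
  have h0 : (0 : ℝ) ∈ X := by
    have : {i | 0 ≤ l i} = Set.univ := Set.eq_univ_of_forall hl0
    simp only [X, Set.mem_ofPred_eq, this]
    exact Set.infinite_univ
  have hbdd : BddAbove X := ⟨C, fun t (ht : Set.Infinite _) => by
    obtain ⟨i, hi⟩ := ht.nonempty
    exact le_trans hi (hlC i)⟩
  have habove : ∀ t, sSup X < t → {i | t ≤ l i}.Finite := fun t ht => by
    by_contra h
    exact ht.not_ge (le_csSup hbdd h)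
  have hbelow : ∀ t, t < sSup X → {i | l i ≤ t}.Finite := fun t ht => by
    obtain ⟨s, hs, hts⟩ := exists_lt_of_lt_csSup ⟨0, h0⟩ ht
    exact (hgap t s hts).resolve_right hs
  refine ⟨sSup X, le_csSup hbdd h0, ?_, fun ε hε => ?_⟩
  · by_contra hinf
    -- Only finitely many terms lie at or below any given value in `Y`, so if infinitely many lie
    -- below `sSup X`, `Y` has no maximum and contains a strictly increasing sequence.
    let Y : Set ℝ := l '' {i | l i < sSup X}
    have hY : Nonempty Y := (Set.Infinite.nonempty hinf).image l |>.to_subtype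
    have : NoMaxOrder Y := ⟨by
      rintro ⟨_, i, hi, rfl⟩
      obtain ⟨j, hj, hj'⟩ := (Set.Infinite.sdiff hinf (hbelow (l i) hi)).nonempty
      exact ⟨⟨l j, j, hj, rfl⟩, not_le.1 hj'⟩⟩
    obtain ⟨g, hg⟩ := Nat.exists_strictMono Y
    choose f hf using fun n => (g n).2
    refine hinc f fun m n hmn => ?_
    simp only [Function.comp_apply, (hf _).2]
    exact hg hmn
  · refine ((habove (sSup X + ε) (by linarith)).union (hbelow (sSup X - ε) (by linarith))).subset ?_
    intro i (hi : ε < |l i - sSup X|)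
    rcases lt_abs.1 hi with h | h
    · exact Or.inl (show sSup X + ε ≤ l i by linarith)
    · exact Or.inr (show l i ≤ sSup X - ε by linarith)

/-- A positive absolutely norm attaining operator on an infinite dimensional Hilbert space is a
scalar `α` plus a norm limit of finite rank operators, and it is bounded below by `α` on a subspace
of finite codimension. -/
theorem exists_scalar_of_absolutelyNormAttaining {A : E →L[ℂ] E} (hE : ¬ FiniteDimensional ℂ E)
    (hA : A.IsPositive) (hAN : AbsolutelyNormAttaining A) :
    ∃ α : ℝ, 0 ≤ α ∧
      (∀ ε > 0, ∃ K : E →L[ℂ] E, FiniteDimensional ℂ K.range ∧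
        ‖A - (α : ℂ) • ContinuousLinearMap.id ℂ E - K‖ ≤ ε) ∧
      ∃ W : Submodule ℂ E, FiniteDimensional ℂ W ∧ ∀ x ∈ Wᗮ, α * ‖x‖ ≤ ‖A x‖ := by
  obtain ⟨ι, b, l, hl0, hl⟩ := exists_hilbertBasis_of_absolutelyNormAttaining hA hAN
  have hι : Infinite ι := by
    by_contra h
    have : Finite ι := not_infinite_iff_finite.1 h
    have := Fintype.ofFinite ι
    exact hE b.toOrthonormalBasis.toBasis.finiteDimensional_of_finite
  have hnormA : ∀ i, ‖A (b i)‖ = l i := fun i => by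
    rw [hl, norm_smul, b.orthonormal.1, mul_one, Complex.norm_real, Real.norm_of_nonneg (hl0 i)]
  obtain ⟨α, hα, hlow, hlim⟩ := exists_limit_of_finite_or_finite (l := l) (C := ‖A‖) hl0
    (fun i => by simpa [hnormA, b.orthonormal.1] using A.le_opNorm (b i))
    (fun r s hrs => finite_or_finite_of_absolutelyNormAttaining hAN b.orthonormal hl0 hl hrs)
    (fun f hf => by
      have hinj : Function.Injective f := hf.injective.of_comp
      refine hAN.not_strictMono_norm (b.orthonormal.comp f hinj) (fun m n hmn => ?_) ?_
      · simp [hl, b.orthonormal.2 (hinj.ne hmn)]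
      · simpa only [Function.comp_def, hnormA] using hf)
  have hsa := hA.isSelfAdjoint
  refine ⟨α, hα, fun ε hε => ?_, Submodule.span ℂ (b '' {i | l i < α}),
    FiniteDimensional.span_of_finite ℂ (hlow.image b), fun x hx => ?_⟩
  -- Truncating `A - α` to `V` leaves a diagonal operator with entries at most `ε` in modulus.
  · let V := Submodule.span ℂ (b '' {i | ε < |l i - α|})
    have hV : FiniteDimensional ℂ V := FiniteDimensional.span_of_finite ℂ ((hlim ε hε).image b)
    refine ⟨(A - (α : ℂ) • ContinuousLinearMap.id ℂ E) ∘L V.starProjection, ?_, ?_⟩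
    · have : ((A - (α : ℂ) • ContinuousLinearMap.id ℂ E) ∘L V.starProjection).range ≤
          V.map (A - (α : ℂ) • ContinuousLinearMap.id ℂ E).toLinearMap := by
        rintro _ ⟨x, rfl⟩
        exact ⟨_, V.starProjection_apply_mem x, rfl⟩
      exact Submodule.finiteDimensional_of_le this
    · refine opNorm_le_bound _ hε.le fun x => ?_
      set y := x - V.starProjection x with hy
      have hyV : y ∈ Vᗮ := V.sub_starProjection_mem_orthogonal x
      have hyx : ‖y‖ ≤ ‖x‖ := by
        have : y = Vᗮ.starProjection x := by
          rw [Submodule.starProjection_orthogonal']; simp [hy]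
        rw [this]
        exact Vᗮ.norm_starProjection_apply_le x
      have happ : (A - (α : ℂ) • ContinuousLinearMap.id ℂ E - (A - (α : ℂ) •
          ContinuousLinearMap.id ℂ E) ∘L V.starProjection) x = A y - (α : ℂ) • y := by
        simp only [hy, sub_apply, comp_apply, smul_apply, id_apply, map_sub, smul_sub]
        abel
      rw [happ]
      refine le_trans ?_ (mul_le_mul_of_nonneg_left hyx hε.le)
      have : ε * ‖y‖ = ‖(ε : ℂ) • y‖ := by
        rw [norm_smul, Complex.norm_real, Real.norm_of_nonneg hε.le]
      rw [this]
      refine norm_le_norm_of_hilbertBasis b fun i => ?_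
      rw [inner_sub_right, inner_smul_right, inner_smul_right,
        inner_apply_eq_of_apply_eq_smul hsa (hl i), ← sub_mul, norm_mul, norm_mul,
        ← Complex.ofReal_sub, Complex.norm_real, Complex.norm_real, Real.norm_of_nonneg hε.le,
        Real.norm_eq_abs]
      by_cases hi : ε < |l i - α|
      · rw [(Submodule.mem_orthogonal _ _).1 hyV _ (Submodule.subset_span ⟨i, hi, rfl⟩)]
        simp
      · exact mul_le_mul_of_nonneg_right (not_lt.1 hi) (norm_nonneg _)
  · have : α * ‖x‖ = ‖(α : ℂ) • x‖ := by
      rw [norm_smul, Complex.norm_real, Real.norm_of_nonneg hα]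
    rw [this]
    refine norm_le_norm_of_hilbertBasis b fun i => ?_
    rw [inner_smul_right, inner_apply_eq_of_apply_eq_smul hsa (hl i), norm_mul, norm_mul,
      Complex.norm_real, Complex.norm_real, Real.norm_of_nonneg hα, Real.norm_of_nonneg (hl0 i)]
    by_cases hi : l i < α
    · rw [(Submodule.mem_orthogonal _ _).1 hx _ (Submodule.subset_span ⟨i, hi, rfl⟩)]
      simp
    · exact mul_le_mul_of_nonneg_right (not_lt.1 hi) (norm_nonneg _)

end Diagonalization

/-! ### Fredholmness of compact and finite-rank perturbations of scalars. -/

section EssentialSpectrum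

variable {E F : Type*}
  [NormedAddCommGroup E] [InnerProductSpace ℂ E]
  [NormedAddCommGroup F] [InnerProductSpace ℂ F]

theorem IsCompactOperator.of_forall_eq {X Y : Type*} [Zero X] [TopologicalSpace X]
    [TopologicalSpace Y] {f g : X → Y} (hg : IsCompactOperator g)
    (h : ∀ x, f x = g x) : IsCompactOperator f :=
  (funext h : f = g) ▸ hg

theorem isCompactOperator_of_finiteDimensional_range {K : E →L[ℂ] F}
    (hK : FiniteDimensional ℂ K.range) : IsCompactOperator K :=
  have := FiniteDimensional.proper ℂ K.range
  (isCompactOperator_of_locallyCompactSpace_dom K.rangeRestrict).clm_comp K.range.subtypeL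

theorem isCompactOperator_of_forall_exists_finiteDimensional_range [CompleteSpace F]
    {T : E →L[ℂ] F}
    (hT : ∀ ε > 0, ∃ K : E →L[ℂ] F, FiniteDimensional ℂ K.range ∧ ‖T - K‖ ≤ ε) :
    IsCompactOperator T := by
  have hcl : IsClosed {f : E →L[ℂ] F | IsCompactOperator f} := isClosed_setOfPred_isCompactOperator
  refine hcl.closure_subset (Metric.mem_closure_iff.2 fun ε hε => ?_)
  obtain ⟨K, hK, hle⟩ := hT (ε / 2) (half_pos hε)
  exact ⟨K, isCompactOperator_of_finiteDimensional_range hK,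
    by rw [dist_eq_norm]; exact hle.trans_lt (half_lt_self hε)⟩

theorem finiteDimensional_of_isCompactOperator_smul_id {c : ℂ} (hc : c ≠ 0)
    (h : IsCompactOperator (c • ContinuousLinearMap.id ℂ E)) : FiniteDimensional ℂ E := by
  refine .of_isCompactOperator_id ?_
  have h2 := h.clm_comp (c⁻¹ • ContinuousLinearMap.id ℂ E)
  refine IsCompactOperator.of_forall_eq h2 fun x => ?_
  simp [hc]

/-- An inverse `V` modulo finite rank would make the identity compact, being `V K` minus a
finite-rank operator. -/
theorem not_isFredholm_of_isCompactOperator (hE : ¬ FiniteDimensional ℂ E) {K : E →L[ℂ] E}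
    (hK : IsCompactOperator K) : ¬ K.IsFredholm := by
  intro h
  obtain ⟨V, hV, -⟩ := h.exists_isQuasiInverse
  have hfin := LinearMap.FiniteRangeSetoid.equiv_iff_hasFiniteRange.1 hV
  have hfin' : FiniteDimensional ℂ (V ∘L K - ContinuousLinearMap.id ℂ E).range :=
    Module.Finite.iff_fg.2 (LinearMap.hasFiniteRange_iff_range.1 hfin)
  refine hE (.of_isCompactOperator_id ?_)
  have := (hK.clm_comp V).sub (isCompactOperator_of_finiteDimensional_range hfin')
  refine IsCompactOperator.of_forall_eq this fun x => ?_
  simp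

/-- By the Neumann series `T - K` is invertible, and its inverse inverts `T` modulo finite rank. -/
theorem isFredholm_of_norm_sub_lt [CompleteSpace E] {T K : E →L[ℂ] E} {c : ℂ}
    (hK : FiniteDimensional ℂ K.range)
    (hT : ‖T - c • ContinuousLinearMap.id ℂ E - K‖ < ‖c‖) : T.IsFredholm := by
  have hc : c ≠ 0 := norm_pos_iff.1 ((norm_nonneg _).trans_lt hT)
  set L := T - c • ContinuousLinearMap.id ℂ E - K with hL
  have hu : IsUnit (1 - -(c⁻¹ • L)) := by
    refine isUnit_one_sub_of_norm_lt_one ?_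
    rw [norm_neg, norm_smul, norm_inv, inv_mul_lt_one₀ (norm_pos_iff.2 hc)]
    exact hT
  obtain ⟨u, hu⟩ := hu
  have hTu : T = c • (u : E →L[ℂ] E) + K := by
    rw [hu, sub_neg_eq_add, smul_add, smul_inv_smul₀ hc, hL, ContinuousLinearMap.one_def]
    abel
  have hK' : K.toLinearMap.HasFiniteRange :=
    LinearMap.hasFiniteRange_iff_range.2 (Module.Finite.iff_fg.1 hK)
  have h1 : ∀ x, ((u⁻¹ : (E →L[ℂ] E)ˣ) : E →L[ℂ] E) ((u : E →L[ℂ] E) x) = x :=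
    DFunLike.congr_fun u.inv_mul
  have h2 : ∀ x, (u : E →L[ℂ] E) (((u⁻¹ : (E →L[ℂ] E)ˣ) : E →L[ℂ] E) x) = x :=
    DFunLike.congr_fun u.mul_inv
  set V := c⁻¹ • ((u⁻¹ : (E →L[ℂ] E)ˣ) : E →L[ℂ] E) with hV
  have e1 : V.toLinearMap ∘ₗ T.toLinearMap - LinearMap.id = V.toLinearMap ∘ₗ K.toLinearMap :=
    LinearMap.ext fun x => by simp [hTu, hV, h1, hc]
  have e2 : T.toLinearMap ∘ₗ V.toLinearMap - LinearMap.id = K.toLinearMap ∘ₗ V.toLinearMap :=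
    LinearMap.ext fun x => by simp [hTu, hV, h2, hc]
  refine .of_isQuasiInverse (v := V) ⟨?_, ?_⟩
  · exact LinearMap.FiniteRangeSetoid.equiv_iff_hasFiniteRange.2
      ((congrArg LinearMap.HasFiniteRange e1).mpr (hK'.comp_left _))
  · exact LinearMap.FiniteRangeSetoid.equiv_iff_hasFiniteRange.2
      ((congrArg LinearMap.HasFiniteRange e2).mpr (hK'.comp_right _))

theorem essentialSpectrum_eq_singleton [CompleteSpace E] (hE : ¬ FiniteDimensional ℂ E)
    {A : E →L[ℂ] E} {α : ℂ}
    (hA : ∀ ε > 0, ∃ K : E →L[ℂ] E, FiniteDimensional ℂ K.range ∧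
      ‖A - α • ContinuousLinearMap.id ℂ E - K‖ ≤ ε) : essentialSpectrum A = {α} := by
  ext μ
  simp only [essentialSpectrum, Set.mem_ofPred_eq, Set.mem_singleton_iff]
  constructor
  · contrapose!
    intro hμ
    have hpos : 0 < ‖α - μ‖ := norm_pos_iff.2 (sub_ne_zero.2 hμ.symm)
    obtain ⟨K, hK, hle⟩ := hA (‖α - μ‖ / 2) (half_pos hpos)
    refine isFredholm_of_norm_sub_lt (c := α - μ) hK (lt_of_le_of_lt (le_of_eq_of_le ?_ hle)
      (half_lt_self hpos))
    congr 1
    module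
  · rintro rfl
    exact not_isFredholm_of_isCompactOperator hE
      (isCompactOperator_of_forall_exists_finiteDimensional_range hA)

theorem eq_of_isCompactOperator_sub_smul_id (hE : ¬ FiniteDimensional ℂ E) {A : E →L[ℂ] E}
    {c d : ℂ} (hc : IsCompactOperator (A - c • ContinuousLinearMap.id ℂ E))
    (hd : IsCompactOperator (A - d • ContinuousLinearMap.id ℂ E)) : c = d := by
  by_contra hcd
  refine hE (finiteDimensional_of_isCompactOperator_smul_id (sub_ne_zero.2 hcd) ?_)
  refine IsCompactOperator.of_forall_eq (hd.sub hc) fun x => ?_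
  simp only [smul_apply, sub_apply, id_apply, Pi.sub_apply]
  module

end EssentialSpectrum

/-! ### Transfer between the direct sum and its summands. -/

section Block

variable {E F : Type*}
  [NormedAddCommGroup E] [InnerProductSpace ℂ E]
  [NormedAddCommGroup F] [InnerProductSpace ℂ F]

/-- The isometric embedding of the first summand of a Hilbert space direct sum. -/
noncomputable def inlₗᵢ (E F : Type*) [NormedAddCommGroup E] [InnerProductSpace ℂ E]
    [NormedAddCommGroup F] [InnerProductSpace ℂ F] : E →ₗᵢ[ℂ] WithLp 2 (E × F) where
  toLinearMap := (WithLp.linearEquiv 2 ℂ (E × F)).symm.toLinearMap ∘ₗ LinearMap.inl ℂ E F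
  norm_map' x := by simp

/-- The isometric embedding of the second summand of a Hilbert space direct sum. -/
noncomputable def inrₗᵢ (E F : Type*) [NormedAddCommGroup E] [InnerProductSpace ℂ E]
    [NormedAddCommGroup F] [InnerProductSpace ℂ F] : F →ₗᵢ[ℂ] WithLp 2 (E × F) where
  toLinearMap := (WithLp.linearEquiv 2 ℂ (E × F)).symm.toLinearMap ∘ₗ LinearMap.inr ℂ E F
  norm_map' x := by simp

theorem blockDiagonal_inl (A : E →L[ℂ] E) (B : F →L[ℂ] F) (x : E) :
    blockDiagonal A B (inlₗᵢ E F x) = inlₗᵢ E F (A x) := by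
  simp [blockDiagonal_apply, inlₗᵢ]

theorem blockDiagonal_inr (A : E →L[ℂ] E) (B : F →L[ℂ] F) (x : F) :
    blockDiagonal A B (inrₗᵢ E F x) = inrₗᵢ E F (B x) := by
  simp [blockDiagonal_apply, inrₗᵢ]

theorem isPositive_blockDiagonal {A : E →L[ℂ] E} {B : F →L[ℂ] F} (hA : A.IsPositive)
    (hB : B.IsPositive) : (blockDiagonal A B).IsPositive := by
  refine (isPositive_iff _).2 ⟨?_, fun z => ?_⟩
  · intro x y
    simp [blockDiagonal_apply, WithLp.prod_inner_apply, hA.inner_left_eq_inner_right,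
      hB.inner_left_eq_inner_right]
  · rw [blockDiagonal_apply, WithLp.prod_inner_apply]
    exact add_nonneg (hA.inner_nonneg_left _) (hB.inner_nonneg_left _)

theorem blockDiagonal_sub_smul_id (A : E →L[ℂ] E) (B : F →L[ℂ] F) (c : ℂ) :
    blockDiagonal A B - c • ContinuousLinearMap.id ℂ _ =
      blockDiagonal (A - c • ContinuousLinearMap.id ℂ E) (B - c • ContinuousLinearMap.id ℂ F) := by
  ext1 z
  simp only [sub_apply, smul_apply, id_apply, blockDiagonal_apply]
  rfl

theorem isCompactOperator_blockDiagonal {A : E →L[ℂ] E} {B : F →L[ℂ] F} (hA : IsCompactOperator A)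
    (hB : IsCompactOperator B) : IsCompactOperator (blockDiagonal A B) := by
  have h1 := (hA.comp_clm (WithLp.fstL 2 ℂ E F)).clm_comp
    (inlₗᵢ E F).toContinuousLinearMap
  have h2 := (hB.comp_clm (WithLp.sndL 2 ℂ E F)).clm_comp
    (inrₗᵢ E F).toContinuousLinearMap
  refine IsCompactOperator.of_forall_eq (h1.add h2) fun z => ?_
  refine (WithLp.equiv 2 (E × F)).injective (Prod.ext ?_ ?_)
  · simp [blockDiagonal_apply, inlₗᵢ, inrₗᵢ]
  · simp [blockDiagonal_apply, inlₗᵢ, inrₗᵢ]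

theorem IsCompactOperator.of_blockDiagonal_left {A : E →L[ℂ] E} {B : F →L[ℂ] F}
    (h : IsCompactOperator (blockDiagonal A B)) : IsCompactOperator A := by
  have := (h.comp_clm (inlₗᵢ E F).toContinuousLinearMap).clm_comp (WithLp.fstL 2 ℂ E F)
  refine IsCompactOperator.of_forall_eq this fun x => ?_
  simp [blockDiagonal_inl]
  simp [inlₗᵢ]

theorem IsCompactOperator.of_blockDiagonal_right {A : E →L[ℂ] E} {B : F →L[ℂ] F}
    (h : IsCompactOperator (blockDiagonal A B)) : IsCompactOperator B := by
  have := (h.comp_clm (inrₗᵢ E F).toContinuousLinearMap).clm_comp (WithLp.sndL 2 ℂ E F)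
  refine IsCompactOperator.of_forall_eq this fun x => ?_
  simp [blockDiagonal_inr]
  simp [inrₗᵢ]

/-- A direct sum of operators, each bounded below by `α` on a subspace of finite codimension, has
the same property. -/
theorem exists_finiteDimensional_blockDiagonal {A : E →L[ℂ] E} {B : F →L[ℂ] F} {α : ℝ}
    (hα : 0 ≤ α) {V : Submodule ℂ E} {W : Submodule ℂ F} [FiniteDimensional ℂ V]
    [FiniteDimensional ℂ W] (hV : ∀ x ∈ Vᗮ, α * ‖x‖ ≤ ‖A x‖) (hW : ∀ x ∈ Wᗮ, α * ‖x‖ ≤ ‖B x‖) :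
    ∃ U : Submodule ℂ (WithLp 2 (E × F)), FiniteDimensional ℂ U ∧
      ∀ z ∈ Uᗮ, α * ‖z‖ ≤ ‖blockDiagonal A B z‖ := by
  refine ⟨V.map (inlₗᵢ E F).toLinearMap ⊔ W.map (inrₗᵢ E F).toLinearMap, inferInstance, ?_⟩
  intro z hz
  rw [Submodule.mem_orthogonal] at hz
  have h1 : z.fst ∈ Vᗮ := by
    refine (Submodule.mem_orthogonal _ _).2 fun v hv => ?_
    have := hz _ (Submodule.mem_sup_left ⟨v, hv, rfl⟩)
    simpa [WithLp.prod_inner_apply, inlₗᵢ] using this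
  have h2 : z.snd ∈ Wᗮ := by
    refine (Submodule.mem_orthogonal _ _).2 fun v hv => ?_
    have := hz _ (Submodule.mem_sup_right ⟨v, hv, rfl⟩)
    simpa [WithLp.prod_inner_apply, inrₗᵢ] using this
  refine pow_le_pow_iff_left₀ (by positivity) (norm_nonneg _) two_ne_zero |>.1 ?_
  rw [mul_pow, WithLp.prod_norm_sq_eq_of_L2, WithLp.prod_norm_sq_eq_of_L2, mul_add, ← mul_pow,
    ← mul_pow]
  exact add_le_add (pow_le_pow_left₀ (by positivity) (hV _ h1) 2)
    (pow_le_pow_left₀ (by positivity) (hW _ h2) 2)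

end Block

/-- The direct sum of two positive operators on infinite dimensional Hilbert spaces is absolutely norm
attaining if and only if both are and their essential spectra agree. -/
theorem absolutelyNormAttaining_blockDiagonal_iff
    {H₁ H₂ : Type*}
    [NormedAddCommGroup H₁] [InnerProductSpace ℂ H₁] [CompleteSpace H₁]
    [NormedAddCommGroup H₂] [InnerProductSpace ℂ H₂] [CompleteSpace H₂]
    (hH₁ : ¬ FiniteDimensional ℂ H₁) (hH₂ : ¬ FiniteDimensional ℂ H₂)
    (A₁ : H₁ →L[ℂ] H₁) (A₂ : H₂ →L[ℂ] H₂) (hA₁ : A₁.IsPositive) (hA₂ : A₂.IsPositive) :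
    AbsolutelyNormAttaining (blockDiagonal A₁ A₂) ↔
      (AbsolutelyNormAttaining A₁ ∧ AbsolutelyNormAttaining A₂) ∧
        essentialSpectrum A₁ = essentialSpectrum A₂ := by
  constructor
  · intro hT
    have h1 : AbsolutelyNormAttaining A₁ :=
      hT.of_linearIsometry (inlₗᵢ H₁ H₂) (inlₗᵢ H₁ H₂) (blockDiagonal_inl A₁ A₂)
    have h2 : AbsolutelyNormAttaining A₂ :=
      hT.of_linearIsometry (inrₗᵢ H₁ H₂) (inrₗᵢ H₁ H₂) (blockDiagonal_inr A₁ A₂)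
    refine ⟨⟨h1, h2⟩, ?_⟩
    have hfin : ¬ FiniteDimensional ℂ (WithLp 2 (H₁ × H₂)) := fun h =>
      hH₁ (.of_injective (inlₗᵢ H₁ H₂).toLinearMap (inlₗᵢ H₁ H₂).injective)
    obtain ⟨α, -, hα, -⟩ :=
      exists_scalar_of_absolutelyNormAttaining hfin (isPositive_blockDiagonal hA₁ hA₂) hT
    obtain ⟨α₁, -, hα₁, -⟩ := exists_scalar_of_absolutelyNormAttaining hH₁ hA₁ h1
    obtain ⟨α₂, -, hα₂, -⟩ := exists_scalar_of_absolutelyNormAttaining hH₂ hA₂ h2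
    have hc := isCompactOperator_of_forall_exists_finiteDimensional_range hα
    rw [blockDiagonal_sub_smul_id] at hc
    -- Both `α₁` and `α₂` are rewritten to the scalar `α` of the direct sum, by uniqueness of a
    -- scalar modulo compacts.
    rw [essentialSpectrum_eq_singleton hH₁ hα₁, essentialSpectrum_eq_singleton hH₂ hα₂,
      eq_of_isCompactOperator_sub_smul_id hH₁
        (isCompactOperator_of_forall_exists_finiteDimensional_range hα₁)
        (IsCompactOperator.of_blockDiagonal_left hc),
      eq_of_isCompactOperator_sub_smul_id hH₂
        (isCompactOperator_of_forall_exists_finiteDimensional_range hα₂)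
        (IsCompactOperator.of_blockDiagonal_right hc)]
  · rintro ⟨⟨h1, h2⟩, hess⟩
    obtain ⟨α, hα, hα₁, V, hVfin, hV⟩ := exists_scalar_of_absolutelyNormAttaining hH₁ hA₁ h1
    obtain ⟨β, -, hα₂, W, hWfin, hW⟩ := exists_scalar_of_absolutelyNormAttaining hH₂ hA₂ h2
    rw [essentialSpectrum_eq_singleton hH₁ hα₁, essentialSpectrum_eq_singleton hH₂ hα₂,
      Set.singleton_eq_singleton_iff, Complex.ofReal_inj] at hess
    subst hess
    obtain ⟨U, hUfin, hU⟩ := exists_finiteDimensional_blockDiagonal hα hV hW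
    refine absolutelyNormAttaining_of_isCompactOperator_sub
      (isPositive_blockDiagonal hA₁ hA₂).isSelfAdjoint hα ?_ U hU
    rw [blockDiagonal_sub_smul_id]
    exact isCompactOperator_blockDiagonal
      (isCompactOperator_of_forall_exists_finiteDimensional_range hα₁)
      (isCompactOperator_of_forall_exists_finiteDimensional_range hα₂)

end BlockAN

theorem mainTheorem10
    {H₁ H₂ : Type*}
    [NormedAddCommGroup H₁] [InnerProductSpace ℂ H₁] [CompleteSpace H₁]
    [TopologicalSpace.SeparableSpace H₁]
    [NormedAddCommGroup H₂] [InnerProductSpace ℂ H₂] [CompleteSpace H₂]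
    [TopologicalSpace.SeparableSpace H₂]
    (hH₁ : ¬ FiniteDimensional ℂ H₁) (hH₂ : ¬ FiniteDimensional ℂ H₂)
    (A₁ : H₁ →L[ℂ] H₁) (A₂ : H₂ →L[ℂ] H₂) (hA₁ : A₁.IsPositive) (hA₂ : A₂.IsPositive) :
    BlockAN.AbsolutelyNormAttaining (BlockAN.blockDiagonal A₁ A₂) ↔
      (BlockAN.AbsolutelyNormAttaining A₁ ∧ BlockAN.AbsolutelyNormAttaining A₂) ∧
        BlockAN.essentialSpectrum A₁ = BlockAN.essentialSpectrum A₂ :=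
  BlockAN.absolutelyNormAttaining_blockDiagonal_iff hH₁ hH₂ A₁ A₂ hA₁ hA₂
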